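/- Let $\mathcal X$ be a finite alphabet, $P_X,P_Y$ pmfs on $\mathcal X$, $d:\mathcal X\times\mathcal X\to[0,\infty)$ a distortion with $d(i,i)=0$, and $L_{\max}\ge 0$. Logarithms are to base $2$, $\mathcal D(P\|Q)\in[0,\infty]$ is the Kullback–Leibler divergence, and $\mathrm{EMD}(P,Q)=\min\sum_{i,j}S(i,j)d(i,j)$ over all $S\ge 0$ on $\mathcal X\times\mathcal X$ with first marginal $P$ and second marginal $Q$. In the source identification game with known sources ($SI_{ks}$) of length $n$ and false-positive exponent $\lambda>0$, the defender chooses an acceptance region $\Lambda$, a set of types (empirical pmfs) with denominator $n$, such that $P_{fp}=P_X^n\{x^n:\text{type}(x^n)\notin\Lambda\}\le 2^{-\lambda n}$. The attacker assigns to every $y^n\in\mathcal X^n$ a transportation map $S(\cdot,\cdot;y^n)$ with entries in $\frac1n\mathbb N$, first marginal $\text{type}(y^n)$ and $\sum_{i,j}S(i,j;y^n)d(i,j)\le L_{\max}$. The false-negative probability $P_{fn}$ is the probability under $P_Y^n$ that the second marginal of $S(\cdot,\cdot;y^n)$ lies in $\Lambda$; the attacker maximizes it and the defender minimizes it. Then,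 with $\Gamma(P_X,L_{\max})=\{P:\mathrm{EMD}(P,P_X)\le L_{\max}\}$, the minimum of $\mathcal D(P\|P_Y)$ over $P\in\Gamma(P_X,L_{\max})$ is attained, and $$\lim_{\lambda\to0^+}\ \lim_{n\to\infty}-\frac1n\log P_{fn}\;=\;\min_{P\in\Gamma(P_X,L_{\max})}\mathcal D(P\|P_Y)\in[0,\infty],$$ where the inner limit exists for all sufficiently small $\lambda>0$ (for all $\lambda>0$ if $P_X\ll P_Y$), and is the same whether $-\frac1n\log P_{fn}$ is taken at the max-min value of the game (the supremum over defender strategies of the infimum over attacker strategies), or at the asymptotic equilibrium profile, in which the defender uses $\Lambda^{n,*}=\{P \text{ a type with denominator } n:\mathcal D(P\|P_X)<\lambda-|\mathcal X|\frac{\log(n+1)}n\}$ and the attacker assigns to each $y^n$ any admissible map whose second marginal has least divergence from $P_X$. (As usual, $-\frac1n\log 0=\infty$.) Moreover the two sources are reliably distinguishable, i.e. for some $\lambda,\varepsilon>0$ and all large $n$ the defender has an acceptance region with $P_{fp}\le2^{-\lambda n}$ for which $P_{fn}\le2^{-\varepsilon n}$ whatever the attacker does, if and only if $\mathrm{EMD}(P_Y,P_X)>L_{\max}$.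 -/

import Mathlib

open Filter Topology

namespace SourceId

/-- Kullback-Leibler divergence (base 2) of `P` from `Q` on a finite alphabet, with the conventions
`0 log 0 = 0` and `p log (p / 0) = ∞` for `p > 0`. -/
noncomputable def klDiv {α : Type*} [Fintype α] (P Q : α → ℝ) : EReal :=
  open Classical in
  if ∀ a, Q a = 0 → P a = 0 then ((∑ a, P a * Real.logb 2 (P a / Q a) : ℝ) : EReal) else ⊤

/-- First marginal of a transportation map: the mass that leaves `i`. -/
noncomputable def inMarginal {α : Type*} [Fintype α] (S : α → α → ℝ) : α → ℝ :=
  fun i => ∑ j, S i j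

/-- Second marginal of a transportation map: the mass that arrives at `j`. -/
noncomputable def outMarginal {α : Type*} [Fintype α] (S : α → α → ℝ) : α → ℝ :=
  fun j => ∑ i, S i j

/-- Average cost of a transportation map. -/
noncomputable def cost {α : Type*} [Fintype α] (d S : α → α → ℝ) : ℝ :=
  ∑ i, ∑ j, S i j * d i j

/-- Earth Mover Distance: the least cost of a nonnegative map with marginals `P` and `Q`. -/
noncomputable def emd {α : Type*} [Fintype α] (d : α → α → ℝ) (P Q : α → ℝ) : ℝ :=
  sInf {c : ℝ | ∃ S : α → α → ℝ, (∀ i j, 0 ≤ S i j) ∧ inMarginal S = P ∧ outMarginal S = Q ∧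
    c = cost d S}

/-- The pmfs `P` on the alphabet with `EMD(P, PX) ≤ L`. -/
def emdBall {α : Type*} [Fintype α] (d : α → α → ℝ) (PX : α → ℝ) (L : ℝ) : Set (α → ℝ) :=
  {P | P ∈ stdSimplex ℝ α ∧ emd d P PX ≤ L}

/-- Probability that a memoryless source with pmf `P` emits a sequence of length `n` in `A`. -/
noncomputable def seqProb {α : Type*} [Fintype α] {n : ℕ} (P : α → ℝ) (A : Set (Fin n → α)) : ℝ :=
  ∑ x : Fin n → α, A.indicator (fun x => ∏ i, P (x i)) x

/-- The type (empirical pmf) of a sequence. -/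
noncomputable def empType {α : Type*} [DecidableEq α] {n : ℕ} (x : Fin n → α) : α → ℝ :=
  fun a => ((Finset.univ.filter (fun i => x i = a)).card : ℝ) / n

/-- The set of types with denominator `n`. -/
def types (α : Type*) [DecidableEq α] (n : ℕ) : Set (α → ℝ) :=
  Set.range (fun x : Fin n → α => empType x)

/-- False positive error probability of the acceptance region `Λ` (a set of types). -/
noncomputable def falsePos {α : Type*} [Fintype α] [DecidableEq α] (n : ℕ) (PX : α → ℝ)
    (Λ : Set (α → ℝ)) : ℝ :=
  seqProb PX {x : Fin n → α | empType x ∉ Λ}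

/-- Strategies of the defender: unions of type classes with `P_fp ≤ 2 ^ (-l n)`. -/
def defenderStrategies {α : Type*} [Fintype α] [DecidableEq α] (n : ℕ) (PX : α → ℝ) (l : ℝ) :
    Set (Set (α → ℝ)) :=
  {Λ | Λ ⊆ types α n ∧ falsePos n PX Λ ≤ (2 : ℝ) ^ (-(l * n))}

/-- Admissible transportation maps for sequences of length `n` with type `P`: `S i j = N i j / n`
with `N i j` the number of symbols `i` changed into `j`, first marginal `P`, and average
per-letter distortion at most `L`. -/
def admissible {α : Type*} [Fintype α] (n : ℕ) (d : α → α → ℝ) (L : ℝ) (P : α → ℝ) :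
    Set (α → α → ℝ) :=
  {S | (∃ N : α → α → ℕ, ∀ i j, S i j = (N i j : ℝ) / n) ∧ inMarginal S = P ∧ cost d S ≤ L}

/-- Strategies of the attacker: an admissible map for every sequence to be attacked. -/
def attackerStrategies {α : Type*} [Fintype α] [DecidableEq α] (n : ℕ) (d : α → α → ℝ) (L : ℝ) :
    Set ((Fin n → α) → α → α → ℝ) :=
  {σ | ∀ y, σ y ∈ admissible n d L (empType y)}

/-- False negative error probability: the attacked sequence falls in the acceptance region. -/
noncomputable def falseNeg {α : Type*} [Fintype α] {n : ℕ} (PY : α → ℝ)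
    (Λ : Set (α → ℝ)) (σ : (Fin n → α) → α → α → ℝ) : ℝ :=
  seqProb PY {y : Fin n → α | outMarginal (σ y) ∈ Λ}

/-- `-(1/n) log p` (base 2), equal to `∞` for `p = 0`. -/
noncomputable def rate (n : ℕ) (p : ℝ) : EReal :=
  if p = 0 then ⊤ else ((-(1 / (n : ℝ)) * Real.logb 2 p : ℝ) : EReal)

/-- `-(1/n) log P_fn` at the value of the zero-sum game: the defender maximizes the
exponent, the attacker minimizes it. -/
noncomputable def gameRate {α : Type*} [Fintype α] [DecidableEq α] (n : ℕ) (d : α → α → ℝ)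
    (PX PY : α → ℝ) (L l : ℝ) : EReal :=
  ⨆ Λ ∈ defenderStrategies n PX l, ⨅ σ ∈ attackerStrategies n d L, rate n (falseNeg PY Λ σ)

/-- The defender's asymptotically dominant acceptance region. -/
noncomputable def optRegion {α : Type*} [Fintype α] [DecidableEq α] (n : ℕ) (PX : α → ℝ) (l : ℝ) :
    Set (α → ℝ) :=
  {P | P ∈ types α n ∧
    klDiv P PX < ((l - Fintype.card α * (Real.logb 2 ((n : ℝ) + 1) / n) : ℝ) : EReal)}

/-- `σ` attacks every sequence by an admissible map whose output type minimizes the divergence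
from `PX`. -/
def IsOptAttack {α : Type*} [Fintype α] [DecidableEq α] (n : ℕ) (d : α → α → ℝ) (PX : α → ℝ)
    (L : ℝ) (σ : (Fin n → α) → α → α → ℝ) : Prop :=
  σ ∈ attackerStrategies n d L ∧
    ∀ y, ∀ T ∈ admissible n d L (empType y),
      klDiv (outMarginal (σ y)) PX ≤ klDiv (outMarginal T) PX

/-- `e` is the limit in `n` of `-(1/n) log P_fn` for the false positive exponent `l`, both at the
value of the game and at the equilibrium profile (whichever minimizers the attacker picks). -/
def IsFalseNegExponent {α : Type*} [Fintype α] [DecidableEq α] (d : α → α → ℝ) (PX PY : α → ℝ)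
    (L l : ℝ) (e : EReal) : Prop :=
  Tendsto (fun n : ℕ => gameRate n d PX PY L l) atTop (𝓝 e) ∧
  ∀ σ : (n : ℕ) → (Fin n → α) → α → α → ℝ, (∀ n, 0 < n → IsOptAttack n d PX L (σ n)) →
    Tendsto (fun n : ℕ => rate n (falseNeg PY (optRegion n PX l) (σ n))) atTop (𝓝 e)

/-- The defender can make both error probabilities decay exponentially fast, whatever the
attacker does. -/
def ReliablyDistinguishable {α : Type*} [Fintype α] [DecidableEq α] (d : α → α → ℝ)
    (PX PY : α → ℝ) (L : ℝ) : Prop :=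
  ∃ l > (0 : ℝ), ∃ e > (0 : ℝ), ∀ᶠ n : ℕ in atTop, ∃ Λ ∈ defenderStrategies n PX l,
    ∀ σ ∈ attackerStrategies n d L, falseNeg PY Λ σ ≤ (2 : ℝ) ^ (-(e * n))

end SourceId

/-!
The proof is Sanov's theorem for a region that the attacker enlarges, with a compactness argument
for the limit in the false positive exponent `l`.

*Candidate.* Call a transportation map feasible if it has total mass one, cost at most `L`, first
marginal `≪ PY` and second marginal `≪ PX`. On the compact convex set of feasible maps both
`D(first marginal ‖ PY)` and `D(second marginal ‖ PX)` are continuous real functions. The limit for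
the exponent `l` is `exponent l`, the infimum of the first function over the feasible maps for which
the second is at most `l`.

*The attacker cannot do better.* The types with divergence from `PX` below `l` plus the polynomial
correction `|α| log (n + 1) / n` form an acceptance region of the defender by Sanov's upper bound
(`seqProb_le_of_le_klDiv`). A sequence that is moved into it has a type at divergence about
`exponent l` from `PY` at least, so Sanov's bound for `PY` finishes; the correction is harmless
since `exponent` is lower semicontinuous from the right (`exists_gt_forall_le_of_lt_exponent`, by
compactness).

*The attacker does as well.* The region `optRegion` lies in every region that the defender may
choose (`optRegion_subset`), since the rejection of a whole type class costs a false positive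
probability of at least `(n + 1) ^ (-|α|) * 2 ^ (-n D)` (`le_seqProb_empType_eq`). If some feasible
map has second marginal at divergence less than `l`, a convex combination turns `≤ l` into `< l`
(`exists_feasible_lt_lt`), and a feasible map is approximated by maps with denominator `n` of no
larger cost and no larger support (`exists_grid_approx`). The attacker then wins on a whole type
class whose `PY`-divergence is almost optimal (`eventually_rate_le`).

*The limit `l → 0`.* If a feasible map has second marginal `PX`, as when `PX ≪ PY`, the preceding
applies to all `l > 0`; otherwise `exponent l = ⊤` for all small `l`, where the first bound alone
suffices. In both cases `exponent l → exponent 0`, which is the attained minimum of the divergence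
over the Earth Mover ball, because the infimum defining the distance is attained (`emd_le_iff`).
By Gibbs' inequality `exponent 0` is positive exactly if `PY` is outside the ball, and this
is the criterion for reliable distinguishability.
-/

namespace SourceId

/-! ### Type classes and their size -/

section Sequences
variable {α : Type*}

open Classical in
/-- The number of occurrences of each symbol in a sequence. -/
noncomputable def symCount {n : ℕ} (x : Fin n → α) (a : α) : ℕ :=
  (Finset.univ.filter fun i => x i = a).card

lemma empType_apply [DecidableEq α] {n : ℕ} (x : Fin n → α) (a : α) :
    empType x a = (symCount x a : ℝ) / n := by
  unfold empType symCount
  congr!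

lemma sum_comp_eq_sum_symCount [Fintype α] {n : ℕ} (x : Fin n → α) (h : α → ℝ) :
    ∑ i, h (x i) = ∑ a, (symCount x a : ℝ) * h a := by
  classical
  rw [← Finset.sum_fiberwise' Finset.univ x h]
  refine Finset.sum_congr rfl fun a _ => ?_
  simp [symCount]

lemma prod_comp_eq_prod_pow [Fintype α] {n : ℕ} (x : Fin n → α) (h : α → ℝ) :
    ∏ i, h (x i) = ∏ a, h a ^ symCount x a := by
  classical
  rw [← Finset.prod_fiberwise' Finset.univ x h]
  refine Finset.prod_congr rfl fun a _ => ?_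
  simp [symCount]

lemma sum_symCount [Fintype α] {n : ℕ} (x : Fin n → α) : ∑ a, symCount x a = n := by
  have := sum_comp_eq_sum_symCount x (fun _ => 1)
  simp only [mul_one, Finset.sum_const, Finset.card_univ, Fintype.card_fin, nsmul_eq_mul] at this
  exact_mod_cast this.symm

lemma symCount_le [Fintype α] {n : ℕ} (x : Fin n → α) (a : α) : symCount x a ≤ n :=
  (Finset.single_le_sum (fun _ _ => Nat.zero_le _) (Finset.mem_univ a)).trans_eq (sum_symCount x)

lemma empType_mem_stdSimplex [Fintype α] [DecidableEq α] {n : ℕ} (hn : 0 < n) (x : Fin n → α) :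
    empType x ∈ stdSimplex ℝ α := by
  refine ⟨fun a => by rw [empType_apply]; positivity, ?_⟩
  simp only [empType_apply, ← Finset.sum_div]
  rw [← Nat.cast_sum, sum_symCount, div_self (by positivity)]

lemma empType_pos [DecidableEq α] {n : ℕ} (x : Fin n → α) (i : Fin n) : 0 < empType x (x i) := by
  have hn : 0 < n := i.pos
  have : 0 < symCount x (x i) := by
    classical
    exact Finset.card_pos.2 ⟨i, by simp⟩
  rw [empType_apply]
  positivity

/-- Every count vector with total `n` is realized by a sequence of length `n`. -/
lemma exists_symCount_eq [Fintype α] {n : ℕ} (k : α → ℕ) (hk : ∑ a, k a = n) :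
    ∃ x : Fin n → α, symCount x = k := by
  classical
  have e : Fin n ≃ Σ a, Fin (k a) := Fintype.equivOfCardEq (by simp [hk])
  refine ⟨fun i => (e i).1, funext fun a => ?_⟩
  unfold symCount
  rw [← Fintype.card_subtype, ← Fintype.card_fin (k a)]
  refine Fintype.card_congr ((e.subtypeEquiv (q := fun s => s.1 = a) fun i => Iff.rfl).trans ?_)
  exact Equiv.sigmaSubtype a

/-- Two sequences with the same symbol counts are permutations of each other. -/
lemma exists_perm_of_symCount_eq {n : ℕ} {x z : Fin n → α} (h : symCount z = symCount x) :
    ∃ g : Equiv.Perm (Fin n), x ∘ g = z := by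
  classical
  have e : ∀ a, Nonempty ({i // z i = a} ≃ {i // x i = a}) := fun a => by
    refine ⟨Fintype.equivOfCardEq ?_⟩
    rw [Fintype.card_subtype, Fintype.card_subtype]
    exact congrFun h a
  refine ⟨Equiv.ofFiberEquiv (f := z) (g := x) fun a => (e a).some, ?_⟩
  funext i
  exact Equiv.ofFiberEquiv_map _ i

open Classical in
/-- The type class of `x`: the sequences with the same symbol counts. -/
noncomputable def typeClass {n : ℕ} [Fintype α] (x : Fin n → α) : Finset (Fin n → α) :=
  Finset.univ.filter fun z => symCount z = symCount x

lemma mem_typeClass {n : ℕ} [Fintype α] {x z : Fin n → α} :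
    z ∈ typeClass x ↔ symCount z = symCount x := by
  simp [typeClass]

/-- The size of a type class is a multinomial coefficient: the symmetric group acts transitively on
it, and the stabilizer of `x` permutes the positions of each symbol. -/
lemma card_typeClass_mul [Fintype α] {n : ℕ} (x : Fin n → α) :
    (typeClass x).card * ∏ a, (symCount x a).factorial = n.factorial := by
  classical
  have hstab : ∏ a, (symCount x a).factorial
      = (Finset.univ.filter fun g : Equiv.Perm (Fin n) => x ∘ g = x).card := by
    rw [← Fintype.card_subtype, DomMulAct.stabilizer_card x]
    refine Finset.prod_congr rfl fun a _ => ?_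
    rw [Fintype.card_subtype]
    unfold symCount
    congr!
  have hmaps : ∀ g ∈ (Finset.univ : Finset (Equiv.Perm (Fin n))), x ∘ g ∈ typeClass x := by
    intro g _
    rw [mem_typeClass]
    funext a
    unfold symCount
    rw [← Fintype.card_subtype, ← Fintype.card_subtype]
    exact Fintype.card_congr (g.subtypeEquiv fun i => Iff.rfl)
  have hfib : ∀ z ∈ typeClass x,
      (Finset.univ.filter fun g : Equiv.Perm (Fin n) => x ∘ g = z).card
        = ∏ a, (symCount x a).factorial := by
    intro z hz
    obtain ⟨g₀, hg₀⟩ := exists_perm_of_symCount_eq (mem_typeClass.1 hz)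
    rw [hstab, ← Fintype.card_subtype, ← Fintype.card_subtype]
    refine Fintype.card_congr ((Equiv.mulRight g₀⁻¹).subtypeEquiv fun g => ?_)
    rw [← hg₀]
    constructor
    · intro h
      funext i
      have := congrFun h (g₀⁻¹ i)
      simpa using this
    · intro h
      funext i
      have := congrFun h (g₀ i)
      simpa using this
  have := Finset.card_eq_sum_card_fiberwise hmaps
  rw [Finset.sum_congr rfl hfib, Finset.sum_const, smul_eq_mul, Finset.card_univ,
    Fintype.card_perm, Fintype.card_fin] at this
  exact this.symm

/-- `m ^ k / k!` is largest at `k = m`. -/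
lemma pow_mul_factorial_le (m k : ℕ) :
    m ^ k * m.factorial ≤ m ^ m * k.factorial := by
  rcases le_total k m with h | h
  · obtain ⟨j, rfl⟩ := Nat.exists_eq_add_of_le h
    have h2 : (k + j).factorial ≤ k.factorial * (k + j) ^ j := by
      rw [← Nat.factorial_mul_ascFactorial]
      exact Nat.mul_le_mul_left _ (Nat.ascFactorial_le_pow_add k j)
    rw [pow_add]
    nlinarith [Nat.zero_le ((k + j) ^ k)]
  · obtain ⟨j, rfl⟩ := Nat.exists_eq_add_of_le h
    have h2 : m.factorial * m ^ j ≤ (m + j).factorial := by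
      simpa using Nat.factorial_mul_pow_sub_le_factorial h
    rw [pow_add]
    nlinarith [Nat.zero_le (m ^ m)]

/-- Under the product of its own type, no type class is more probable than that of `x₀`. -/
lemma card_mul_prod_pow_le [Fintype α] {n : ℕ} (x₀ x : Fin n → α) :
    ((typeClass x).card : ℝ) * ∏ a, (symCount x₀ a : ℝ) ^ symCount x a
      ≤ (typeClass x₀).card * ∏ a, (symCount x₀ a : ℝ) ^ symCount x₀ a := by
  have h : ∏ a, (symCount x₀ a ^ symCount x a * (symCount x₀ a).factorial)
      ≤ ∏ a, (symCount x₀ a ^ symCount x₀ a * (symCount x a).factorial) :=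
    Finset.prod_le_prod' fun a _ => pow_mul_factorial_le _ _
  rw [Finset.prod_mul_distrib, Finset.prod_mul_distrib] at h
  have h1 := card_typeClass_mul x
  have h0 := card_typeClass_mul x₀
  have hp : 0 < (∏ a, (symCount x a).factorial) * ∏ a, (symCount x₀ a).factorial :=
    Nat.mul_pos (Finset.prod_pos fun a _ => Nat.factorial_pos _)
      (Finset.prod_pos fun a _ => Nat.factorial_pos _)
  have key : (typeClass x).card * ∏ a, symCount x₀ a ^ symCount x a
      ≤ (typeClass x₀).card * ∏ a, symCount x₀ a ^ symCount x₀ a := by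
    refine Nat.le_of_mul_le_mul_right ?_ hp
    calc _ = n.factorial * ((∏ a, symCount x₀ a ^ symCount x a)
              * ∏ a, (symCount x₀ a).factorial) := by rw [← h1]; ring
      _ ≤ n.factorial * ((∏ a, symCount x₀ a ^ symCount x₀ a)
              * ∏ a, (symCount x a).factorial) := Nat.mul_le_mul_left _ h
      _ = _ := by rw [← h0]; ring
  exact_mod_cast key

end Sequences

variable {α : Type*} [Fintype α]

/-! ### Probabilities of type classes -/

/-- The divergence of `P` from `Q` as a real number, meaningful when `P ≪ Q`; it is continuous in
`P` on the whole space, since a symbol with `Q a = 0` contributes `P a * log (P a / 0) = 0`. -/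
noncomputable def klSum (P Q : α → ℝ) : ℝ := ∑ a, P a * Real.logb 2 (P a / Q a)

lemma klDiv_of_ac {P Q : α → ℝ} (h : ∀ a, Q a = 0 → P a = 0) : klDiv P Q = klSum P Q := by
  unfold klDiv klSum
  exact if_pos h

lemma klDiv_of_not_ac {P Q : α → ℝ} (h : ¬ ∀ a, Q a = 0 → P a = 0) : klDiv P Q = ⊤ := by
  unfold klDiv
  exact if_neg h

lemma ac_of_klDiv_ne_top {P Q : α → ℝ} (h : klDiv P Q ≠ ⊤) : ∀ a, Q a = 0 → P a = 0 := by
  by_contra h'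
  exact h (klDiv_of_not_ac h')

lemma seqProb_nonneg {n : ℕ} {P : α → ℝ} (hP : ∀ a, 0 ≤ P a) (A : Set (Fin n → α)) :
    0 ≤ seqProb P A :=
  Finset.sum_nonneg fun _ _ =>
    Set.indicator_nonneg (fun _ _ => Finset.prod_nonneg fun _ _ => hP _) _

lemma seqProb_mono {n : ℕ} {P : α → ℝ} (hP : ∀ a, 0 ≤ P a) {A B : Set (Fin n → α)} (h : A ⊆ B) :
    seqProb P A ≤ seqProb P B :=
  Finset.sum_le_sum fun _ _ => Set.indicator_le_indicator_of_subset h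
    (fun _ => Finset.prod_nonneg fun _ _ => hP _) _

section Types
variable [DecidableEq α]

/-- The change of measure behind the method of types: a sequence of type `Q` has probability
`2 ^ (-n D(Q‖P))` times the probability that it has under `Q` itself. -/
lemma prod_eq_rpow_mul_prod_empType {n : ℕ} {P : α → ℝ} (hP : ∀ a, 0 ≤ P a) (x : Fin n → α)
    (h : ∀ a, P a = 0 → empType x a = 0) :
    ∏ i, P (x i) = (2 : ℝ) ^ (-(klSum (empType x) P * n)) * ∏ i, empType x (x i) := by
  have hsum : klSum (empType x) P * n = ∑ i, Real.logb 2 (empType x (x i) / P (x i)) := by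
    rw [sum_comp_eq_sum_symCount x fun a => Real.logb 2 (empType x a / P a), klSum, Finset.sum_mul]
    refine Finset.sum_congr rfl fun a _ => ?_
    rcases Nat.eq_zero_or_pos n with rfl | hn
    · have := symCount_le x a
      simp [show symCount x a = 0 by omega]
    · have : (symCount x a : ℝ) = empType x a * n := by
        rw [empType_apply]; field_simp
      rw [this]; ring
  rw [hsum, ← Finset.sum_neg_distrib, Real.rpow_sum_of_pos two_pos, ← Finset.prod_mul_distrib]
  refine Finset.prod_congr rfl fun i _ => ?_
  have hQ := empType_pos x i
  -- both pmfs are positive at every symbol that occurs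
  have hPpos : 0 < P (x i) := (hP _).lt_of_ne' fun h0 => hQ.ne' (h _ h0)
  rw [Real.rpow_neg two_pos.le, Real.rpow_logb two_pos (by norm_num) (by positivity)]
  field_simp

omit [Fintype α] in
lemma empType_congr {n : ℕ} {x z : Fin n → α} (h : symCount z = symCount x) :
    empType z = empType x := by
  funext a
  rw [empType_apply, empType_apply, h]

lemma symCount_eq_of_empType_eq {n : ℕ} {x z : Fin n → α} (h : empType z = empType x) :
    symCount z = symCount x := by
  funext a
  have := congrFun h a
  rw [empType_apply, empType_apply] at this
  rcases Nat.eq_zero_or_pos n with rfl | hn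
  · have h1 := symCount_le x a
    have h2 := symCount_le z a
    omega
  · have hn' : (n : ℝ) ≠ 0 := by positivity
    exact_mod_cast (div_left_inj' hn').1 this

omit [DecidableEq α] in
lemma sum_prod_eq_one {n : ℕ} {Q : α → ℝ} (hQ : Q ∈ stdSimplex ℝ α) :
    ∑ x : Fin n → α, ∏ i, Q (x i) = 1 := by
  classical
  have := (Fintype.sum_pow Q n).symm
  rw [hQ.2, one_pow] at this
  exact this

/-- The possible count vectors of sequences of length `n`; there are at most
`(n + 1) ^ |α|` of them. -/
def countVectors (α : Type*) [Fintype α] [DecidableEq α] (n : ℕ) : Finset (α → ℕ) :=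
  Fintype.piFinset fun _ => Finset.range (n + 1)

lemma card_countVectors (n : ℕ) :
    ((countVectors α n).card : ℝ) = ((n : ℝ) + 1) ^ Fintype.card α := by
  simp [countVectors]

lemma sum_eq_sum_countVectors {n : ℕ} (f : (Fin n → α) → ℝ) :
    ∑ x, f x = ∑ k ∈ countVectors α n, ∑ x with symCount x = k, f x := by
  refine (Finset.sum_fiberwise_of_maps_to (fun x _ => ?_) f).symm
  simp only [countVectors, Fintype.mem_piFinset, Finset.mem_range]
  exact fun a => Nat.lt_succ_of_le (symCount_le x a)

/-- Every type class has probability at most one under its own type, so the sum over all sequences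
is at most the number of types. -/
lemma sum_prod_empType_le {n : ℕ} (hn : 0 < n) :
    ∑ x : Fin n → α, ∏ i, empType x (x i) ≤ ((n : ℝ) + 1) ^ Fintype.card α := by
  rw [sum_eq_sum_countVectors, ← card_countVectors, ← nsmul_one, ← Finset.sum_const]
  refine Finset.sum_le_sum fun k _ => ?_
  by_cases hk : ∃ x : Fin n → α, symCount x = k
  · obtain ⟨x, rfl⟩ := hk
    have hQ := empType_mem_stdSimplex hn x
    calc _ = ∑ z : Fin n → α with symCount z = symCount x, ∏ i, empType x (z i) := by
          refine Finset.sum_congr rfl fun z hz => ?_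
          rw [empType_congr (Finset.mem_filter.1 hz).2]
      _ ≤ ∑ z : Fin n → α, ∏ i, empType x (z i) :=
          Finset.sum_le_sum_of_subset_of_nonneg (Finset.subset_univ _)
            fun z _ _ => Finset.prod_nonneg fun i _ => hQ.1 _
      _ = 1 := sum_prod_eq_one hQ
  · rw [Finset.sum_eq_zero]
    · exact zero_le_one
    · exact fun x hx => (hk ⟨x, (Finset.mem_filter.1 hx).2⟩).elim

/-- A type class has probability at least `(n + 1) ^ (-|α|)` under its own type, since it is the
most probable of at most `(n + 1) ^ |α|` type classes. -/
lemma one_le_mul_sum_typeClass {n : ℕ} (hn : 0 < n) (x₀ : Fin n → α) :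
    1 ≤ ((n : ℝ) + 1) ^ Fintype.card α * ∑ z ∈ typeClass x₀, ∏ i, empType x₀ (z i) := by
  have hcalc : ∀ x : Fin n → α, ∑ z ∈ typeClass x, ∏ i, empType x₀ (z i)
      = ((typeClass x).card * ∏ a, (symCount x₀ a : ℝ) ^ symCount x a) / (n : ℝ) ^ n := by
    intro x
    have : ∀ z ∈ typeClass x, ∏ i, empType x₀ (z i)
        = (∏ a, (symCount x₀ a : ℝ) ^ symCount x a) / (n : ℝ) ^ n := by
      intro z hz
      rw [prod_comp_eq_prod_pow z, mem_typeClass.1 hz]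
      simp only [empType_apply, div_pow]
      rw [Finset.prod_div_distrib, Finset.prod_pow_eq_pow_sum, sum_symCount]
    rw [Finset.sum_congr rfl this, Finset.sum_const, nsmul_eq_mul, mul_div_assoc]
  rw [← card_countVectors, ← nsmul_eq_mul, ← Finset.sum_const]
  refine (sum_prod_eq_one (n := n) (empType_mem_stdSimplex hn x₀)).symm.trans_le ?_
  rw [sum_eq_sum_countVectors]
  refine Finset.sum_le_sum fun k _ => ?_
  by_cases hk : ∃ x : Fin n → α, symCount x = k
  · obtain ⟨x, rfl⟩ := hk
    have : (Finset.univ.filter fun z : Fin n → α => symCount z = symCount x) = typeClass x := by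
      ext z; simp [mem_typeClass]
    rw [this, hcalc, hcalc]
    exact div_le_div_of_nonneg_right (card_mul_prod_pow_le x₀ x) (by positivity)
  · rw [Finset.sum_eq_zero]
    · exact Finset.sum_nonneg fun z _ => Finset.prod_nonneg fun i _ =>
        (empType_mem_stdSimplex hn x₀).1 _
    · exact fun x hx => (hk ⟨x, (Finset.mem_filter.1 hx).2⟩).elim

/-- Sanov's upper bound. -/
lemma seqProb_le_of_le_klDiv {n : ℕ} (hn : 0 < n) {P : α → ℝ} (hP : ∀ a, 0 ≤ P a)
    {A : Set (Fin n → α)} {c : ℝ} (h : ∀ x ∈ A, (c : EReal) ≤ klDiv (empType x) P) :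
    seqProb P A ≤ ((n : ℝ) + 1) ^ Fintype.card α * (2 : ℝ) ^ (-(c * n)) := by
  refine le_trans ?_ (mul_le_mul_of_nonneg_right (sum_prod_empType_le hn) (by positivity))
  rw [Finset.sum_mul]
  refine Finset.sum_le_sum fun x _ => ?_
  have hQ : 0 ≤ ∏ i, empType x (x i) := Finset.prod_nonneg fun i _ => (empType_pos x i).le
  by_cases hx : x ∈ A
  · rw [Set.indicator_of_mem hx]
    by_cases hac : ∀ a, P a = 0 → empType x a = 0
    · have hc := h x hx
      rw [klDiv_of_ac hac, EReal.coe_le_coe_iff] at hc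
      rw [prod_eq_rpow_mul_prod_empType hP x hac, mul_comm]
      refine mul_le_mul_of_nonneg_left ?_ hQ
      refine Real.rpow_le_rpow_of_exponent_le one_le_two ?_
      have : c * n ≤ klSum (empType x) P * n := mul_le_mul_of_nonneg_right hc (by positivity)
      linarith
    -- a symbol of `x` has probability zero, so `x` contributes nothing
    · push Not at hac
      obtain ⟨a, ha, hxa⟩ := hac
      have : ∃ i, x i = a := by
        by_contra hno
        push Not at hno
        refine hxa ?_
        rw [empType_apply]
        simp [symCount, hno]
      obtain ⟨i, hi⟩ := this
      rw [Finset.prod_eq_zero (Finset.mem_univ i) (by rw [hi, ha])]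
      positivity
  · rw [Set.indicator_of_notMem hx]
    positivity

/-- Lower bound on the probability of a single type class. -/
lemma le_seqProb_empType_eq {n : ℕ} (hn : 0 < n) {P : α → ℝ} (hP : ∀ a, 0 ≤ P a)
    (x₀ : Fin n → α) (hac : ∀ a, P a = 0 → empType x₀ a = 0) :
    (2 : ℝ) ^ (-(klSum (empType x₀) P * n))
      ≤ ((n : ℝ) + 1) ^ Fintype.card α * seqProb P {x : Fin n → α | empType x = empType x₀} := by
  have h1 : seqProb P {x : Fin n → α | empType x = empType x₀}
      = (2 : ℝ) ^ (-(klSum (empType x₀) P * n))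
        * ∑ z ∈ typeClass x₀, ∏ i, empType x₀ (z i) := by
    have hset : ∀ x : Fin n → α,
        x ∈ {x : Fin n → α | empType x = empType x₀} ↔ x ∈ typeClass x₀ := fun x => by
      rw [mem_typeClass]
      exact ⟨symCount_eq_of_empType_eq, empType_congr⟩
    rw [seqProb, Finset.mul_sum]
    simp only [Set.indicator_apply, hset]
    rw [Finset.sum_ite_mem, Finset.univ_inter]
    refine Finset.sum_congr rfl fun x hx => ?_
    have hQ : empType x = empType x₀ := (hset x).2 hx
    rw [prod_eq_rpow_mul_prod_empType hP x (by rwa [hQ]), hQ]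
  rw [h1]
  have := mul_le_mul_of_nonneg_left (one_le_mul_sum_typeClass hn x₀)
    (by positivity : (0 : ℝ) ≤ (2 : ℝ) ^ (-(klSum (empType x₀) P * n)))
  linarith
end Types

/-! ### Divergence on a finite alphabet -/

lemma mul_logb_div_eq (q p : ℝ) :
    p * Real.logb 2 (p / q) = q / Real.log 2 * (p / q * Real.log (p / q)) := by
  rcases eq_or_ne q 0 with rfl | hq
  · simp
  · rw [Real.logb]; field_simp

lemma continuous_klSum (Q : α → ℝ) : Continuous fun P : α → ℝ => klSum P Q := by
  unfold klSum
  simp only [mul_logb_div_eq]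
  refine continuous_finsetSum _ fun a _ => continuous_const.mul ?_
  exact Real.continuous_mul_log.comp (by fun_prop : Continuous fun P : α → ℝ => P a / Q a)

lemma klSum_convex {Q : α → ℝ} (hQ : ∀ a, 0 ≤ Q a) {P P' : α → ℝ} (hP : ∀ a, 0 ≤ P a)
    (hP' : ∀ a, 0 ≤ P' a) {s t : ℝ} (hs : 0 ≤ s) (ht : 0 ≤ t) (hst : s + t = 1) :
    klSum (fun a => s * P a + t * P' a) Q ≤ s * klSum P Q + t * klSum P' Q := by
  unfold klSum
  rw [Finset.mul_sum, Finset.mul_sum, ← Finset.sum_add_distrib]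
  refine Finset.sum_le_sum fun a _ => ?_
  simp only [mul_logb_div_eq]
  have h := Real.convexOn_mul_log.2 (x := P a / Q a) (y := P' a / Q a)
    (div_nonneg (hP a) (hQ a)) (div_nonneg (hP' a) (hQ a)) hs ht hst
  simp only [smul_eq_mul] at h
  have hc : 0 ≤ Q a / Real.log 2 := div_nonneg (hQ a) (Real.log_nonneg one_le_two)
  have := mul_le_mul_of_nonneg_left h hc
  rw [show (s * P a + t * P' a) / Q a = s * (P a / Q a) + t * (P' a / Q a) by ring]
  linarith

/-- The divergence as a sum of nonnegative terms; `klFun x = x log x + 1 - x` vanishes only at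
`x = 1`. -/
lemma log_two_mul_klSum {P Q : α → ℝ} (hP : P ∈ stdSimplex ℝ α) (hQ : Q ∈ stdSimplex ℝ α)
    (hac : ∀ a, Q a = 0 → P a = 0) :
    Real.log 2 * klSum P Q = ∑ a, Q a * InformationTheory.klFun (P a / Q a) := by
  have h2 : Real.log 2 ≠ 0 := (Real.log_pos one_lt_two).ne'
  have : ∀ a, Q a * InformationTheory.klFun (P a / Q a)
      = Real.log 2 * (P a * Real.logb 2 (P a / Q a)) + Q a - P a := by
    intro a
    rcases eq_or_ne (Q a) 0 with hq | hq
    · simp [hq, hac a hq]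
    · rw [InformationTheory.klFun, Real.logb]; field_simp
  simp only [this, Finset.sum_add_distrib, Finset.sum_sub_distrib, hP.2, hQ.2]
  rw [klSum, Finset.mul_sum]; ring

/-- Gibbs' inequality. -/
lemma klSum_nonneg {P Q : α → ℝ} (hP : P ∈ stdSimplex ℝ α) (hQ : Q ∈ stdSimplex ℝ α)
    (hac : ∀ a, Q a = 0 → P a = 0) : 0 ≤ klSum P Q := by
  have h := log_two_mul_klSum hP hQ hac
  have h2 : 0 ≤ Real.log 2 * klSum P Q := by
    rw [h]
    exact Finset.sum_nonneg fun a _ => mul_nonneg (hQ.1 a)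
      (InformationTheory.klFun_nonneg (div_nonneg (hP.1 a) (hQ.1 a)))
  exact nonneg_of_mul_nonneg_right h2 (Real.log_pos one_lt_two)

lemma eq_of_klSum_nonpos {P Q : α → ℝ} (hP : P ∈ stdSimplex ℝ α) (hQ : Q ∈ stdSimplex ℝ α)
    (hac : ∀ a, Q a = 0 → P a = 0) (h0 : klSum P Q ≤ 0) : P = Q := by
  have h := log_two_mul_klSum hP hQ hac
  rw [h0.antisymm (klSum_nonneg hP hQ hac), mul_zero] at h
  have hnn : ∀ a ∈ Finset.univ, 0 ≤ Q a * InformationTheory.klFun (P a / Q a) := fun a _ =>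
    mul_nonneg (hQ.1 a) (InformationTheory.klFun_nonneg (div_nonneg (hP.1 a) (hQ.1 a)))
  funext a
  rcases eq_or_ne (Q a) 0 with hq | hq
  · rw [hq, hac a hq]
  · have := (Finset.sum_eq_zero_iff_of_nonneg hnn).1 h.symm a (Finset.mem_univ a)
    have := (mul_eq_zero.1 this).resolve_left hq
    rw [InformationTheory.klFun_eq_zero_iff (div_nonneg (hP.1 a) (hQ.1 a))] at this
    exact (div_eq_one_iff_eq hq).1 this

lemma klSum_self (Q : α → ℝ) : klSum Q Q = 0 := by
  refine Finset.sum_eq_zero fun a _ => ?_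
  rcases eq_or_ne (Q a) 0 with hq | hq
  · simp [hq]
  · simp [div_self hq]

/-! ### Couplings and the Earth Mover Distance -/

lemma continuous_inMarginal : Continuous (inMarginal : (α → α → ℝ) → α → ℝ) := by
  unfold inMarginal; fun_prop

lemma continuous_outMarginal : Continuous (outMarginal : (α → α → ℝ) → α → ℝ) := by
  unfold outMarginal; fun_prop

lemma continuous_cost (d : α → α → ℝ) : Continuous (cost d) := by
  unfold cost; fun_prop

lemma isCompact_transport :
    IsCompact {S : α → α → ℝ | (∀ i j, 0 ≤ S i j) ∧ ∑ i, ∑ j, S i j = 1} := by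
  refine (isCompact_Icc (a := (0 : α → α → ℝ)) (b := 1)).of_isClosed_subset ?_ ?_
  · simp only [Set.ofPred_and, Set.ofPred_forall]
    refine IsClosed.inter ?_ (isClosed_eq (by fun_prop) continuous_const)
    exact isClosed_iInter fun i => isClosed_iInter fun j =>
      isClosed_le continuous_const (by fun_prop)
  · rintro S ⟨h0, h1⟩
    refine ⟨fun i j => h0 i j, fun i j => ?_⟩
    calc S i j ≤ ∑ j, S i j := Finset.single_le_sum (fun j _ => h0 i j) (Finset.mem_univ j)
      _ ≤ ∑ i, ∑ j, S i j := Finset.single_le_sum (f := fun i => ∑ j, S i j)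
          (fun i _ => Finset.sum_nonneg fun j _ => h0 i j) (Finset.mem_univ i)
      _ = 1 := h1

lemma inMarginal_mem_stdSimplex {S : α → α → ℝ} (h0 : ∀ i j, 0 ≤ S i j)
    (h1 : ∑ i, ∑ j, S i j = 1) : inMarginal S ∈ stdSimplex ℝ α :=
  ⟨fun i => Finset.sum_nonneg fun j _ => h0 i j, h1⟩

lemma outMarginal_mem_stdSimplex {S : α → α → ℝ} (h0 : ∀ i j, 0 ≤ S i j)
    (h1 : ∑ i, ∑ j, S i j = 1) : outMarginal S ∈ stdSimplex ℝ α :=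
  ⟨fun j => Finset.sum_nonneg fun i _ => h0 i j, by
    unfold outMarginal; rw [Finset.sum_comm]; exact h1⟩

/-- The infimum defining the Earth Mover Distance is attained. -/
lemma emd_le_iff {d : α → α → ℝ} {P Q : α → ℝ}
    (hP : P ∈ stdSimplex ℝ α) (hQ : Q ∈ stdSimplex ℝ α) {L : ℝ} :
    emd d P Q ≤ L ↔ ∃ S : α → α → ℝ, (∀ i j, 0 ≤ S i j) ∧ inMarginal S = P ∧ outMarginal S = Q ∧
      cost d S ≤ L := by
  set K : Set (α → α → ℝ) :=
    {S | (∀ i j, 0 ≤ S i j) ∧ inMarginal S = P ∧ outMarginal S = Q} with hK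
  have himg : {c : ℝ | ∃ S : α → α → ℝ, (∀ i j, 0 ≤ S i j) ∧ inMarginal S = P ∧
      outMarginal S = Q ∧ c = cost d S} = cost d '' K := by
    ext c
    constructor
    · rintro ⟨S, h0, h1, h2, rfl⟩
      exact ⟨S, ⟨h0, h1, h2⟩, rfl⟩
    · rintro ⟨S, ⟨h0, h1, h2⟩, rfl⟩
      exact ⟨S, h0, h1, h2, rfl⟩
  have hcomp : IsCompact K := by
    refine isCompact_transport.of_isClosed_subset ?_ ?_
    · simp only [hK, Set.ofPred_and, Set.ofPred_forall]
      refine IsClosed.inter ?_ (IsClosed.inter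
        (isClosed_eq continuous_inMarginal continuous_const)
        (isClosed_eq continuous_outMarginal continuous_const))
      exact isClosed_iInter fun i => isClosed_iInter fun j =>
        isClosed_le continuous_const (by fun_prop)
    · rintro S ⟨h0, h1, -⟩
      refine ⟨h0, ?_⟩
      rw [← hP.2, ← h1]; rfl
  have hne : K.Nonempty := by
    refine ⟨fun i j => P i * Q j, fun i j => mul_nonneg (hP.1 i) (hQ.1 j), ?_, ?_⟩
    · funext i
      simp only [inMarginal]
      rw [← Finset.mul_sum, hQ.2, mul_one]
    · funext j
      simp only [outMarginal]
      rw [← Finset.sum_mul, hP.2, one_mul]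
  have hc2 := hcomp.image (continuous_cost d)
  unfold emd
  rw [himg]
  constructor
  · intro h
    obtain ⟨S, ⟨h0, h1, h2⟩, h3⟩ := hc2.sInf_mem (hne.image _)
    exact ⟨S, h0, h1, h2, h3.trans_le h⟩
  · rintro ⟨S, h0, h1, h2, h3⟩
    exact (csInf_le hc2.bddBelow ⟨S, ⟨h0, h1, h2⟩, rfl⟩).trans h3

/-! ### Approximation by types -/

/-- A pmf is approximated by pmfs with denominator `n` on its own support, without raising its mean
cost: round all masses down and give what is left to a cheapest point of the support. -/
lemma exists_grid_approx {ι : Type*} [Fintype ι] {w : ι → ℝ} (hw : w ∈ stdSimplex ℝ ι)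
    (c : ι → ℝ) : ∃ N : ℕ → ι → ℕ, (∀ n, ∑ i, N n i = n) ∧ (∀ n i, w i = 0 → N n i = 0) ∧
      (∀ n, ∑ i, (N n i : ℝ) * c i ≤ n * ∑ i, w i * c i) ∧
      ∀ i, Tendsto (fun n : ℕ => (N n i : ℝ) / n) atTop (𝓝 (w i)) := by
  classical
  obtain ⟨i₀, hi₀, hmin⟩ : ∃ i₀, w i₀ ≠ 0 ∧ ∀ i, w i ≠ 0 → c i₀ ≤ c i := by
    have hne : (Finset.univ.filter fun i => w i ≠ 0).Nonempty := by
      by_contra hcon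
      rw [Finset.not_nonempty_iff_eq_empty, Finset.filter_eq_empty_iff] at hcon
      have h1 := hw.2
      rw [Finset.sum_eq_zero fun i hi => not_not.1 (hcon hi)] at h1
      exact zero_ne_one h1
    obtain ⟨i₀, h, h'⟩ := Finset.exists_min_image _ c hne
    exact ⟨i₀, (Finset.mem_filter.1 h).2, fun i hi => h' i (by simpa using hi)⟩
  set F : ℕ → ι → ℕ := fun n i => ⌊w i * n⌋₊ with hF
  have hFle : ∀ n i, (F n i : ℝ) ≤ w i * n := fun n i =>
    Nat.floor_le (mul_nonneg (hw.1 i) n.cast_nonneg)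
  have hFsum : ∀ n, ∑ i, F n i ≤ n := fun n => by
    have : ∑ i, (F n i : ℝ) ≤ ∑ i, w i * n := Finset.sum_le_sum fun i _ => hFle n i
    rw [← Finset.sum_mul, hw.2, one_mul] at this
    exact_mod_cast this
  -- the number of units lost by rounding down
  set r : ℕ → ℕ := fun n => n - ∑ i, F n i with hr
  have hrcast : ∀ n, (r n : ℝ) = n - ∑ i, (F n i : ℝ) := fun n => by
    rw [hr]; push_cast [Nat.cast_sub (hFsum n)]; rfl
  have hFlim : ∀ i, Tendsto (fun n : ℕ => (F n i : ℝ) / n) atTop (𝓝 (w i)) := fun i =>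
    (tendsto_nat_floor_mul_div_atTop (hw.1 i)).comp tendsto_natCast_atTop_atTop
  have hrlim : Tendsto (fun n : ℕ => (r n : ℝ) / n) atTop (𝓝 0) := by
    have h1 : Tendsto (fun n : ℕ => 1 - ∑ i, (F n i : ℝ) / n) atTop (𝓝 (1 - ∑ i, w i)) :=
      tendsto_const_nhds.sub (tendsto_finsetSum _ fun i _ => hFlim i)
    rw [hw.2, sub_self] at h1
    refine h1.congr' ?_
    filter_upwards [eventually_gt_atTop 0] with n hn
    rw [hrcast, ← Finset.sum_div, sub_div, div_self (by positivity)]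
  refine ⟨fun n i => F n i + if i = i₀ then r n else 0, fun n => ?_, fun n i hi => ?_,
    fun n => ?_, fun i => ?_⟩
  · rw [Finset.sum_add_distrib, Finset.sum_ite_eq' Finset.univ i₀, if_pos (Finset.mem_univ _)]
    exact Nat.add_sub_cancel' (hFsum n)
  · have : i ≠ i₀ := fun h => hi₀ (h ▸ hi)
    simp [hF, hi, this]
  · have h1 : ∀ i, ((F n i + if i = i₀ then r n else 0 : ℕ) : ℝ) * c i
        = F n i * c i + if i = i₀ then r n * c i₀ else 0 := fun i => by
      split_ifs with h
      · subst h; push_cast; ring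
      · simp
    simp only [h1]
    rw [Finset.sum_add_distrib, Finset.sum_ite_eq' Finset.univ i₀, if_pos (Finset.mem_univ _)]
    -- every unit lost at `i` reappears at `i₀`, which is at least as cheap
    have h2 : 0 ≤ ∑ i, (w i * n - F n i) * (c i - c i₀) := by
      refine Finset.sum_nonneg fun i _ => ?_
      rcases eq_or_ne (w i) 0 with h | h
      · simp [hF, h]
      · exact mul_nonneg (sub_nonneg.2 (hFle n i)) (sub_nonneg.2 (hmin i h))
    have h3 : ∑ i, (w i * n - F n i) * (c i - c i₀)
        = n * ∑ i, w i * c i - ∑ i, F n i * c i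
          - ((∑ i, w i) * n - ∑ i, (F n i : ℝ)) * c i₀ := by
      rw [Finset.mul_sum, Finset.sum_mul, ← Finset.sum_sub_distrib, ← Finset.sum_sub_distrib,
        Finset.sum_mul, ← Finset.sum_sub_distrib]
      exact Finset.sum_congr rfl fun i _ => by ring
    rw [h3, hw.2, one_mul, ← hrcast] at h2
    linarith
  · have : Tendsto (fun n : ℕ => (F n i : ℝ) / n + if i = i₀ then (r n : ℝ) / n else 0) atTop
        (𝓝 (w i + 0)) := by
      refine (hFlim i).add ?_
      split_ifs
      · exact hrlim
      · exact tendsto_const_nhds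
    rw [add_zero] at this
    refine this.congr fun n => ?_
    by_cases h : i = i₀ <;> simp [h, add_div]

/-! ### The exponent as an optimization over feasible maps -/

/-- The transportation maps of total mass one and cost at most `L` whose first marginal is
absolutely continuous with respect to `PY` and whose second marginal is absolutely continuous with
respect to `PX`; the two conditions are written as a support condition, which makes the set
compact. -/
def feasible (d : α → α → ℝ) (PX PY : α → ℝ) (L : ℝ) : Set (α → α → ℝ) :=
  {S | ((∀ i j, 0 ≤ S i j) ∧ ∑ i, ∑ j, S i j = 1) ∧ cost d S ≤ L ∧
    ∀ i j, PY i = 0 ∨ PX j = 0 → S i j = 0}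

/-- The error exponent for the false positive exponent `l`: the least divergence from `PY` of a pmf
that can be moved, at cost at most `L`, into the divergence ball of radius `l` around `PX`. It is
`⊤` if there is no such pmf that is absolutely continuous with respect to `PY`. -/
noncomputable def exponent (d : α → α → ℝ) (PX PY : α → ℝ) (L l : ℝ) : EReal :=
  ⨅ S ∈ {S | S ∈ feasible d PX PY L ∧ klSum (outMarginal S) PX ≤ l},
    (klSum (inMarginal S) PY : EReal)

variable {d : α → α → ℝ} {PX PY : α → ℝ} {L : ℝ}

lemma feasible.in_ac {S : α → α → ℝ} (hS : S ∈ feasible d PX PY L) :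
    ∀ i, PY i = 0 → inMarginal S i = 0 :=
  fun i hi => Finset.sum_eq_zero fun j _ => hS.2.2 i j (Or.inl hi)

lemma feasible.out_ac {S : α → α → ℝ} (hS : S ∈ feasible d PX PY L) :
    ∀ j, PX j = 0 → outMarginal S j = 0 :=
  fun j hj => Finset.sum_eq_zero fun i _ => hS.2.2 i j (Or.inr hj)

lemma mem_feasible {S : α → α → ℝ} (h0 : ∀ i j, 0 ≤ S i j) (h1 : ∑ i, ∑ j, S i j = 1)
    (hc : cost d S ≤ L) (hin : ∀ i, PY i = 0 → inMarginal S i = 0)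
    (hout : ∀ j, PX j = 0 → outMarginal S j = 0) : S ∈ feasible d PX PY L := by
  refine ⟨⟨h0, h1⟩, hc, ?_⟩
  rintro i j (h | h)
  · exact (Finset.sum_eq_zero_iff_of_nonneg fun j _ => h0 i j).1 (hin i h) j (Finset.mem_univ j)
  · exact (Finset.sum_eq_zero_iff_of_nonneg fun i _ => h0 i j).1 (hout j h) i (Finset.mem_univ i)

lemma isCompact_feasible : IsCompact (feasible d PX PY L) := by
  refine isCompact_transport.inter_right (IsClosed.inter ?_ ?_)
  · exact isClosed_le (continuous_cost d) continuous_const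
  · change IsClosed {S : α → α → ℝ | ∀ i j, PY i = 0 ∨ PX j = 0 → S i j = 0}
    simp only [Set.ofPred_forall]
    exact isClosed_iInter fun i => isClosed_iInter fun j => isClosed_iInter fun _ =>
      isClosed_eq (by fun_prop) continuous_const

lemma continuous_klSum_in : Continuous fun S : α → α → ℝ => klSum (inMarginal S) PY :=
  (continuous_klSum PY).comp continuous_inMarginal

lemma continuous_klSum_out : Continuous fun S : α → α → ℝ => klSum (outMarginal S) PX :=
  (continuous_klSum PX).comp continuous_outMarginal

lemma feasible_convex {S T : α → α → ℝ} (hS : S ∈ feasible d PX PY L)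
    (hT : T ∈ feasible d PX PY L) {s t : ℝ} (hs : 0 ≤ s) (ht : 0 ≤ t) (hst : s + t = 1) :
    (fun i j => s * S i j + t * T i j) ∈ feasible d PX PY L := by
  refine ⟨⟨fun i j => add_nonneg (mul_nonneg hs (hS.1.1 i j)) (mul_nonneg ht (hT.1.1 i j)), ?_⟩,
    ?_, fun i j h => by simp [hS.2.2 i j h, hT.2.2 i j h]⟩
  · simp only [Finset.sum_add_distrib, ← Finset.mul_sum, hS.1.2, hT.1.2, mul_one, hst]
  · have : cost d (fun i j => s * S i j + t * T i j) = s * cost d S + t * cost d T := by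
      simp only [cost, add_mul, mul_assoc, Finset.sum_add_distrib, ← Finset.mul_sum]
    rw [this]
    calc _ ≤ s * L + t * L := add_le_add (mul_le_mul_of_nonneg_left hS.2.1 hs)
          (mul_le_mul_of_nonneg_left hT.2.1 ht)
      _ = L := by rw [← add_mul, hst, one_mul]

lemma exponent_le {S : α → α → ℝ} (hS : S ∈ feasible d PX PY L) {l : ℝ}
    (hl : klSum (outMarginal S) PX ≤ l) : exponent d PX PY L l ≤ klSum (inMarginal S) PY :=
  iInf₂_le S ⟨hS, hl⟩

lemma exists_of_exponent_lt {l : ℝ} {b : EReal} (h : exponent d PX PY L l < b) :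
    ∃ S ∈ feasible d PX PY L, klSum (outMarginal S) PX ≤ l ∧
      (klSum (inMarginal S) PY : EReal) < b := by
  obtain ⟨S, h⟩ := iInf_lt_iff.1 h
  obtain ⟨hS, h⟩ := iInf_lt_iff.1 h
  exact ⟨S, hS.1, hS.2, h⟩

lemma exponent_antitone : Antitone (exponent d PX PY L) := fun _ _ h =>
  biInf_mono fun _ hS => ⟨hS.1, hS.2.trans h⟩

/-- Lower semicontinuity from the right of the exponent: the compact set of feasible maps with first
marginal at divergence at most `c` stays away from `{klSum (outMarginal S) PX ≤ l}`. -/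
lemma exists_gt_forall_le_of_lt_exponent {l c : ℝ} (h : (c : EReal) < exponent d PX PY L l) :
    ∃ l' > l, ∀ S ∈ feasible d PX PY L, klSum (outMarginal S) PX ≤ l' →
      c ≤ klSum (inMarginal S) PY := by
  have hK : IsCompact (feasible d PX PY L ∩ {S | klSum (inMarginal S) PY ≤ c}) :=
    isCompact_feasible.inter_right (isClosed_le continuous_klSum_in continuous_const)
  rcases Set.eq_empty_or_nonempty (feasible d PX PY L ∩ {S | klSum (inMarginal S) PY ≤ c})
    with he | hne
  -- no feasible map satisfies the bound `c`, so any `l' > l` will do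
  · refine ⟨l + 1, by linarith, fun S hS _ => ?_⟩
    by_contra hcon
    have : S ∈ (∅ : Set (α → α → ℝ)) := he ▸ ⟨hS, (not_le.1 hcon).le⟩
    exact this
  · obtain ⟨S₁, hS₁, hmin⟩ := hK.exists_isMinOn hne
      (continuous_klSum_out (PX := PX)).continuousOn
    have hgt : l < klSum (outMarginal S₁) PX := by
      by_contra hcon
      have h1 := h.trans_le (exponent_le hS₁.1 (not_lt.1 hcon))
      rw [EReal.coe_lt_coe_iff] at h1
      exact absurd hS₁.2 (not_le.2 h1)
    refine ⟨(l + klSum (outMarginal S₁) PX) / 2, by linarith, fun S hS hSl => ?_⟩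
    by_contra hcon
    have : klSum (outMarginal S₁) PX ≤ klSum (outMarginal S) PX :=
      hmin ⟨hS, (not_le.1 hcon).le⟩
    linarith

/-- At `0` the exponent is bounded above by monotonicity and below by semicontinuity. -/
lemma tendsto_exponent :
    Tendsto (exponent d PX PY L) (𝓝[>] (0 : ℝ)) (𝓝 (exponent d PX PY L 0)) := by
  refine tendsto_order.2 ⟨fun a ha => ?_, fun b hb => ?_⟩
  · obtain ⟨c, hac, hc⟩ := EReal.lt_iff_exists_real_btwn.1 ha
    obtain ⟨l', hl', h⟩ := exists_gt_forall_le_of_lt_exponent hc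
    filter_upwards [Ioo_mem_nhdsGT hl'] with l hl
    refine hac.trans_le (le_iInf₂ fun S hS => ?_)
    exact EReal.coe_le_coe_iff.2 (h S hS.1 (hS.2.trans hl.2.le))
  · filter_upwards [self_mem_nhdsWithin] with l hl
    exact (exponent_antitone (le_of_lt hl)).trans_lt hb

/-- Either some feasible map has second marginal `PX`, or the exponent is infinite for all small
`l`. -/
lemma exists_or_eventually_exponent_eq_top :
    (∃ S ∈ feasible d PX PY L, klSum (outMarginal S) PX ≤ 0) ∨
      ∀ᶠ l in 𝓝[>] (0 : ℝ), exponent d PX PY L l = ⊤ := by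
  rcases Set.eq_empty_or_nonempty (feasible d PX PY L) with he | hne
  · refine Or.inr (Eventually.of_forall fun l => ?_)
    simp [exponent, he]
  · obtain ⟨S₁, hS₁, hmin⟩ := isCompact_feasible.exists_isMinOn hne
      (continuous_klSum_out (PX := PX)).continuousOn
    rcases le_or_gt (klSum (outMarginal S₁) PX) 0 with h | h
    · exact Or.inl ⟨S₁, hS₁, h⟩
    · right
      filter_upwards [Ioo_mem_nhdsGT h] with l hl
      by_contra hcon
      obtain ⟨S, hS, hSl, -⟩ := exists_of_exponent_lt (lt_top_iff_ne_top.2 hcon)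
      have : klSum (outMarginal S₁) PX ≤ klSum (outMarginal S) PX := hmin hS
      linarith [hl.2]

/-- A pmf in the Earth Mover ball with finite divergence from `PY` is the first marginal of a
feasible map onto `PX`. -/
lemma exponent_zero_le_klDiv (hPX : PX ∈ stdSimplex ℝ α) {P : α → ℝ} (hP : P ∈ emdBall d PX L) :
    exponent d PX PY L 0 ≤ klDiv P PY := by
  by_cases hac : ∀ a, PY a = 0 → P a = 0
  · obtain ⟨S, h0, h1, h2, hc⟩ := (emd_le_iff hP.1 hPX).1 hP.2
    have hS : S ∈ feasible d PX PY L := by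
      refine mem_feasible h0 ?_ hc (by rwa [h1]) (by simp [h2])
      rw [← hP.1.2, ← h1]; rfl
    have := exponent_le hS (l := 0) (by rw [h2, klSum_self])
    rwa [h1, ← klDiv_of_ac hac] at this
  · rw [klDiv_of_not_ac hac]
    exact le_top

lemma inMarginal_mem_emdBall (hPX : PX ∈ stdSimplex ℝ α) {S : α → α → ℝ}
    (hS : S ∈ feasible d PX PY L) (h : klSum (outMarginal S) PX ≤ 0) :
    inMarginal S ∈ emdBall d PX L := by
  have hin := inMarginal_mem_stdSimplex hS.1.1 hS.1.2
  have hout : outMarginal S = PX :=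
    eq_of_klSum_nonpos (outMarginal_mem_stdSimplex hS.1.1 hS.1.2) hPX (feasible.out_ac hS) h
  exact ⟨hin, (emd_le_iff hin hPX).2 ⟨S, hS.1.1, rfl, hout, hS.2.1⟩⟩

/-- The map that moves nothing. -/
lemma exists_diagonal (hd0 : ∀ i, d i i = 0) {P : α → ℝ} (hP : P ∈ stdSimplex ℝ α) :
    ∃ S : α → α → ℝ, (∀ i j, 0 ≤ S i j) ∧ inMarginal S = P ∧ outMarginal S = P ∧
      cost d S = 0 := by
  classical
  refine ⟨fun i j => if i = j then P i else 0, fun i j => ?_, ?_, ?_, ?_⟩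
  · dsimp only; split_ifs
    exacts [hP.1 i, le_rfl]
  · funext i; simp [inMarginal]
  · funext j; simp [outMarginal]
  · simp [cost, ite_mul, hd0]

lemma self_mem_emdBall (hd0 : ∀ i, d i i = 0) (hL : 0 ≤ L) (hPX : PX ∈ stdSimplex ℝ α) :
    PX ∈ emdBall d PX L := by
  obtain ⟨S, h0, h1, h2, hc⟩ := exists_diagonal hd0 hPX
  exact ⟨hPX, (emd_le_iff hPX hPX).2 ⟨S, h0, h1, h2, hc.trans_le hL⟩⟩

lemma exists_mem_emdBall_klDiv_eq (hd0 : ∀ i, d i i = 0) (hL : 0 ≤ L)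
    (hPX : PX ∈ stdSimplex ℝ α) :
    ∃ P₀ ∈ emdBall d PX L, klDiv P₀ PY = exponent d PX PY L 0 := by
  rcases Set.eq_empty_or_nonempty (feasible d PX PY L ∩ {S | klSum (outMarginal S) PX ≤ 0})
    with he | hne
  · have htop : exponent d PX PY L 0 = ⊤ := by
      by_contra hcon
      obtain ⟨S, hS, hSl, -⟩ := exists_of_exponent_lt (lt_top_iff_ne_top.2 hcon)
      have : S ∈ (∅ : Set (α → α → ℝ)) := he ▸ ⟨hS, hSl⟩
      exact this
    have hball := self_mem_emdBall hd0 hL hPX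
    refine ⟨PX, hball, ?_⟩
    have := exponent_zero_le_klDiv (PY := PY) hPX hball
    rw [htop] at this ⊢
    exact top_le_iff.1 this
  · have hK : IsCompact (feasible d PX PY L ∩ {S | klSum (outMarginal S) PX ≤ 0}) :=
      isCompact_feasible.inter_right (isClosed_le continuous_klSum_out continuous_const)
    obtain ⟨S₁, hS₁, hmin⟩ := hK.exists_isMinOn hne
      (continuous_klSum_in (PY := PY)).continuousOn
    have hball := inMarginal_mem_emdBall hPX hS₁.1 hS₁.2
    refine ⟨_, hball, le_antisymm ?_ (exponent_zero_le_klDiv hPX hball)⟩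
    rw [klDiv_of_ac (feasible.in_ac hS₁.1)]
    exact le_iInf₂ fun S hS => EReal.coe_le_coe_iff.2 (hmin ⟨hS.1, hS.2⟩)

/-- Mixing a map that is almost optimal with one whose second marginal is closer to `PX` than `l`
makes the constraint strict. -/
lemma exists_feasible_lt_lt (hPX : PX ∈ stdSimplex ℝ α) {S₀ : α → α → ℝ}
    (hS₀ : S₀ ∈ feasible d PX PY L) {l c : ℝ}
    (h₀ : klSum (outMarginal S₀) PX < l) (hc : exponent d PX PY L l < c) :
    ∃ S ∈ feasible d PX PY L, klSum (outMarginal S) PX < l ∧ klSum (inMarginal S) PY < c := by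
  obtain ⟨S₁, hS₁, hS₁l, hS₁c⟩ := exists_of_exponent_lt hc
  rw [EReal.coe_lt_coe_iff] at hS₁c
  let T : ℝ → α → α → ℝ := fun t i j => (1 - t) * S₁ i j + t * S₀ i j
  have hcont : Continuous fun t => klSum (inMarginal (T t)) PY :=
    continuous_klSum_in.comp (by fun_prop)
  have hev : ∀ᶠ t in 𝓝[>] (0 : ℝ), klSum (inMarginal (T t)) PY < c := by
    refine (hcont.tendsto 0).eventually (gt_mem_nhds ?_) |>.filter_mono nhdsWithin_le_nhds
    simpa [T] using hS₁c
  -- any small positive weight of `S₀` makes the convex constraint strict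
  obtain ⟨t, htc, ht0, ht1⟩ := (hev.and (Ioo_mem_nhdsGT one_pos)).exists
  refine ⟨T t, feasible_convex hS₁ hS₀ (by linarith) ht0.le (by ring), ?_, htc⟩
  have hout : outMarginal (T t) = fun a => (1 - t) * outMarginal S₁ a + t * outMarginal S₀ a := by
    funext a
    simp only [outMarginal, T, Finset.sum_add_distrib, Finset.mul_sum]
  rw [hout]
  refine (klSum_convex hPX.1 (outMarginal_mem_stdSimplex hS₁.1.1 hS₁.1.2).1
    (outMarginal_mem_stdSimplex hS₀.1.1 hS₀.1.2).1 (by linarith) ht0.le (by ring)).trans_lt ?_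
  nlinarith

/-- Feasible maps are limits of feasible maps with denominator `n`. -/
lemma exists_grid_feasible {S : α → α → ℝ} (hS : S ∈ feasible d PX PY L) :
    ∃ N : ℕ → α → α → ℕ, (∀ n, ∑ i, ∑ j, N n i j = n) ∧
      (∀ n, 0 < n → (fun i j => (N n i j : ℝ) / n) ∈ feasible d PX PY L) ∧
      Tendsto (fun (n : ℕ) i j => (N n i j : ℝ) / n) atTop (𝓝 S) := by
  obtain ⟨N, hN1, hN2, hN3, hN4⟩ := exists_grid_approx (w := fun p : α × α => S p.1 p.2)
    ⟨fun p => hS.1.1 _ _, by rw [Fintype.sum_prod_type]; exact hS.1.2⟩ (fun p => d p.1 p.2)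
  have hsum : ∀ n, ∑ i, ∑ j, N n (i, j) = n := fun n => by
    rw [← Fintype.sum_prod_type]; exact hN1 n
  refine ⟨fun n i j => N n (i, j), hsum, fun n hn => ⟨⟨fun i j => by positivity, ?_⟩, ?_, ?_⟩, ?_⟩
  · simp only [← Finset.sum_div]
    have := hsum n
    rw [show ∑ i, ∑ j, (N n (i, j) : ℝ) = n by exact_mod_cast this]
    exact div_self (by positivity)
  · have h3 := hN3 n
    rw [Fintype.sum_prod_type, Fintype.sum_prod_type] at h3
    have hcost : cost d (fun i j => (N n (i, j) : ℝ) / n)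
        = (∑ i, ∑ j, (N n (i, j) : ℝ) * d i j) / n := by
      simp only [cost, Finset.sum_div]
      exact Finset.sum_congr rfl fun i _ => Finset.sum_congr rfl fun j _ => by ring
    rw [hcost]
    refine (div_le_iff₀' (by positivity)).2 (h3.trans ?_)
    exact mul_le_mul_of_nonneg_left hS.2.1 (by positivity)
  · intro i j h
    simp [hN2 n (i, j) (hS.2.2 i j h)]
  · exact tendsto_pi_nhds.2 fun i => tendsto_pi_nhds.2 fun j => hN4 (i, j)

/-! ### Rates and polynomial factors -/

section Rate

lemma rate_le_of_le {n : ℕ} (hn : 0 < n) {p c : ℝ} (h : (2 : ℝ) ^ (-(c * n)) ≤ p) :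
    rate n p ≤ c := by
  have hp : 0 < p := (Real.rpow_pos_of_pos two_pos _).trans_le h
  rw [rate, if_neg hp.ne', EReal.coe_le_coe_iff]
  have h1 := (Real.le_logb_iff_rpow_le one_lt_two hp).2 h
  have hn' : (0 : ℝ) < n := by positivity
  rw [neg_mul, one_div_mul_eq_div, neg_le, le_div_iff₀ hn']
  linarith

lemma le_rate_of_le {n : ℕ} (hn : 0 < n) {p c : ℝ} (hp : 0 ≤ p) (h : p ≤ (2 : ℝ) ^ (-(c * n))) :
    (c : EReal) ≤ rate n p := by
  rcases hp.eq_or_lt with rfl | hp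
  · simp [rate]
  · rw [rate, if_neg hp.ne', EReal.coe_le_coe_iff]
    have h1 := (Real.logb_le_iff_le_rpow one_lt_two hp).2 h
    have hn' : (0 : ℝ) < n := by positivity
    rw [neg_mul, one_div_mul_eq_div, le_neg, div_le_iff₀ hn']
    linarith

/-- The exponent of the polynomial factor `(n + 1) ^ |α|` of the method of types. -/
noncomputable def polyExponent (α : Type*) [Fintype α] (n : ℕ) : ℝ :=
  Fintype.card α * (Real.logb 2 ((n : ℝ) + 1) / n)

lemma pow_card_eq_rpow {n : ℕ} (hn : 0 < n) :
    ((n : ℝ) + 1) ^ Fintype.card α = (2 : ℝ) ^ (polyExponent α n * n) := by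
  have hn' : (n : ℝ) ≠ 0 := by positivity
  rw [polyExponent, mul_assoc, div_mul_cancel₀ _ hn', mul_comm, Real.rpow_mul two_pos.le,
    Real.rpow_logb two_pos (by norm_num) (by positivity), Real.rpow_natCast]

lemma tendsto_polyExponent : Tendsto (polyExponent α) atTop (𝓝 0) := by
  have h1 : Tendsto (fun n : ℕ => Real.log ((n : ℝ) + 1) / ((n : ℝ) + 1)) atTop (𝓝 0) := by
    have := (Real.isLittleO_log_id_atTop.tendsto_div_nhds_zero).comp
      (tendsto_atTop_add_const_right atTop (1 : ℝ) tendsto_natCast_atTop_atTop)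
    exact this
  have h2 : Tendsto (fun n : ℕ => ((n : ℝ) + 1) / n) atTop (𝓝 1) := by
    have : Tendsto (fun n : ℕ => 1 + 1 / (n : ℝ)) atTop (𝓝 (1 + 0)) :=
      tendsto_const_nhds.add tendsto_one_div_atTop_nhds_zero_nat
    rw [add_zero] at this
    refine this.congr' ?_
    filter_upwards [eventually_gt_atTop 0] with n hn
    field_simp
  have h3 := ((h1.mul h2).div_const (Real.log 2)).const_mul (Fintype.card α : ℝ)
  simp only [zero_mul, zero_div, mul_zero] at h3
  refine h3.congr' ?_
  filter_upwards [eventually_gt_atTop 0] with n hn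
  rw [polyExponent, Real.logb]
  field_simp

end Rate

variable {l : ℝ}

lemma falseNeg_mono {n : ℕ} (hPY : ∀ a, 0 ≤ PY a) {Λ Λ' : Set (α → ℝ)} (h : Λ ⊆ Λ')
    (σ : (Fin n → α) → α → α → ℝ) : falseNeg PY Λ σ ≤ falseNeg PY Λ' σ :=
  seqProb_mono hPY fun _ hy => h hy

/-- The identity map is feasible when its marginal is absolutely continuous with respect to both
sources. -/
lemma exists_feasible_of_ac (hPX : PX ∈ stdSimplex ℝ α) (hd0 : ∀ i, d i i = 0) (hL : 0 ≤ L)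
    (hac : ∀ a, PY a = 0 → PX a = 0) :
    ∃ S ∈ feasible d PX PY L, klSum (outMarginal S) PX ≤ 0 := by
  obtain ⟨S, h0, h1, h2, hc⟩ := exists_diagonal hd0 hPX
  refine ⟨S, mem_feasible h0 ?_ (hc.trans_le hL) (by rwa [h1]) (by simp [h2]), ?_⟩
  · rw [← hPX.2, ← h1]; rfl
  · rw [h2, klSum_self]

/-! ### Admissible maps and types -/

section Admissible
variable [DecidableEq α]

lemma mem_types_of_count {n : ℕ} (k : α → ℕ) (hk : ∑ a, k a = n) :
    ∃ x : Fin n → α, empType x = fun a => (k a : ℝ) / n := by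
  obtain ⟨x, hx⟩ := exists_symCount_eq k hk
  exact ⟨x, funext fun a => by rw [empType_apply, hx]⟩

lemma outMarginal_mem_types {n : ℕ} (hn : 0 < n) (y : Fin n → α) {S : α → α → ℝ}
    (hS : S ∈ admissible n d L (empType y)) : outMarginal S ∈ types α n := by
  obtain ⟨⟨N, hN⟩, hin, -⟩ := hS
  have hn' : (n : ℝ) ≠ 0 := by positivity
  have hrow : ∀ i, ∑ j, N i j = symCount y i := fun i => by
    have := congrFun hin i
    simp only [inMarginal, hN, empType_apply, ← Finset.sum_div] at this
    exact_mod_cast (div_left_inj' hn').1 this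
  obtain ⟨x, hx⟩ := mem_types_of_count (n := n) (fun j => ∑ i, N i j) (by
    rw [Finset.sum_comm, Finset.sum_congr rfl fun i _ => hrow i, sum_symCount])
  refine ⟨x, ?_⟩
  simp only [hx]
  funext j
  simp only [outMarginal, hN, ← Finset.sum_div]
  push_cast; rfl

lemma admissible_mass {n : ℕ} (hn : 0 < n) (y : Fin n → α) {S : α → α → ℝ}
    (hS : S ∈ admissible n d L (empType y)) :
    (∀ i j, 0 ≤ S i j) ∧ ∑ i, ∑ j, S i j = 1 := by
  obtain ⟨⟨N, hN⟩, hin, -⟩ := hS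
  refine ⟨fun i j => by rw [hN]; positivity, ?_⟩
  rw [← (empType_mem_stdSimplex hn y).2, ← hin]; rfl

lemma admissible_nonempty (hd0 : ∀ i, d i i = 0) (hL : 0 ≤ L) {n : ℕ} (y : Fin n → α) :
    (admissible n d L (empType y)).Nonempty := by
  refine ⟨fun i j => if i = j then empType y i else 0,
    ⟨fun i j => if i = j then symCount y i else 0, fun i j => ?_⟩, ?_, ?_⟩
  · dsimp only; split_ifs
    · rw [empType_apply]
    · simp
  · funext i; simp [inMarginal]
  · simpa [cost, ite_mul, hd0] using hL

end Admissible

/-! ### The game and its exponent -/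

section Game
variable [DecidableEq α]

/-- An attack that reaches the region `Λ` whenever some admissible map does. -/
def Reaches (n : ℕ) (d : α → α → ℝ) (L : ℝ) (Λ : Set (α → ℝ)) (σ : (Fin n → α) → α → α → ℝ) :
    Prop :=
  σ ∈ attackerStrategies n d L ∧
    ∀ y, ∀ T ∈ admissible n d L (empType y), outMarginal T ∈ Λ → outMarginal (σ y) ∈ Λ

lemma exists_reaches (hd0 : ∀ i, d i i = 0) (hL : 0 ≤ L) (n : ℕ) (Λ : Set (α → ℝ)) :
    ∃ σ, Reaches n d L Λ σ := by
  have : ∀ y : Fin n → α, ∃ S ∈ admissible n d L (empType y),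
      ∀ T ∈ admissible n d L (empType y), outMarginal T ∈ Λ → outMarginal S ∈ Λ := by
    intro y
    by_cases h : ∃ T ∈ admissible n d L (empType y), outMarginal T ∈ Λ
    · obtain ⟨T, hT, hTΛ⟩ := h
      exact ⟨T, hT, fun _ _ _ => hTΛ⟩
    · obtain ⟨S, hS⟩ := admissible_nonempty hd0 hL y
      exact ⟨S, hS, fun T hT hTΛ => (h ⟨T, hT, hTΛ⟩).elim⟩
  choose σ h1 h2 using this
  exact ⟨σ, h1, h2⟩

lemma IsOptAttack.reaches {n : ℕ} (hn : 0 < n) {σ : (Fin n → α) → α → α → ℝ}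
    (h : IsOptAttack n d PX L σ) : Reaches n d L (optRegion n PX l) σ :=
  ⟨h.1, fun y T hT hTΛ => ⟨outMarginal_mem_types hn y (h.1 y), (h.2 y T hT).trans_lt hTΛ.2⟩⟩

/-- The region `optRegion` is contained in every acceptance region of the defender: rejecting one of
its types would already violate the false positive constraint. -/
lemma optRegion_subset (hPX : ∀ a, 0 ≤ PX a) {n : ℕ} (hn : 0 < n) {Λ : Set (α → ℝ)}
    (hΛ : Λ ∈ defenderStrategies n PX l) : optRegion n PX l ⊆ Λ := by
  rintro _ ⟨⟨x₀, rfl⟩, hlt⟩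
  by_contra hnot
  have hlt : klDiv (empType x₀) PX < ((l - polyExponent α n : ℝ) : EReal) := hlt
  have hac := ac_of_klDiv_ne_top (hlt.trans_le le_top).ne
  rw [klDiv_of_ac hac, EReal.coe_lt_coe_iff] at hlt
  have h1 := le_seqProb_empType_eq hn hPX x₀ hac
  have h2 : seqProb PX {x : Fin n → α | empType x = empType x₀} ≤ (2 : ℝ) ^ (-(l * n)) := by
    refine (seqProb_mono hPX ?_).trans hΛ.2
    intro x hx
    change empType x ∉ Λ
    rwa [show empType x = empType x₀ from hx]
  have hn' : (0 : ℝ) < n := by positivity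
  have h3 := h1.trans (mul_le_mul_of_nonneg_left h2 (by positivity))
  rw [pow_card_eq_rpow hn, ← Real.rpow_add two_pos, Real.rpow_le_rpow_left_iff one_lt_two] at h3
  nlinarith

/-- For every `c` below the exponent, a divergence ball of radius slightly larger than `l` is an
acceptance region of the defender that guarantees a false negative exponent of at least `c`. -/
lemma eventually_exists_region (hPX : ∀ a, 0 ≤ PX a) (hPY : ∀ a, 0 ≤ PY a) {c : ℝ}
    (hc : (c : EReal) < exponent d PX PY L l) :
    ∀ᶠ n : ℕ in atTop, ∃ Λ ∈ defenderStrategies n PX l, optRegion n PX l ⊆ Λ ∧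
      ∀ σ ∈ attackerStrategies n d L, falseNeg PY Λ σ ≤ (2 : ℝ) ^ (-(c * n)) := by
  obtain ⟨c', hcc', hc'⟩ := EReal.lt_iff_exists_real_btwn.1 hc
  rw [EReal.coe_lt_coe_iff] at hcc'
  obtain ⟨l', hl', hS⟩ := exists_gt_forall_le_of_lt_exponent hc'
  have hlim := tendsto_polyExponent (α := α)
  filter_upwards [eventually_gt_atTop 0, hlim.eventually (gt_mem_nhds (sub_pos.2 hl')),
    hlim.eventually (gt_mem_nhds (sub_pos.2 hcc'))] with n hn h1 h2
  have hn' : (0 : ℝ) < n := by positivity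
  have hpe : 0 ≤ polyExponent α n := by
    unfold polyExponent
    have : 0 ≤ Real.logb 2 ((n : ℝ) + 1) := Real.logb_nonneg one_lt_two (by linarith)
    positivity
  -- the correction is added, not subtracted as in `optRegion`: this makes Sanov's bound exactly
  -- `2 ^ (-(l * n))`
  refine ⟨{P | P ∈ types α n ∧ klDiv P PX < ((l + polyExponent α n : ℝ) : EReal)},
    ⟨fun P hP => hP.1, ?_⟩, ?_, ?_⟩
  · refine (seqProb_le_of_le_klDiv hn hPX (c := l + polyExponent α n) ?_).trans_eq ?_
    · intro x hx
      by_contra hcon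
      exact hx ⟨⟨x, rfl⟩, not_le.1 hcon⟩
    · rw [pow_card_eq_rpow hn, ← Real.rpow_add two_pos]
      congr 1; ring
  · rintro P ⟨hP, hlt⟩
    refine ⟨hP, hlt.trans_le (EReal.coe_le_coe_iff.2 ?_)⟩
    change l - polyExponent α n ≤ _
    linarith
  · intro σ hσ
    refine (seqProb_le_of_le_klDiv hn hPY (c := c') ?_).trans ?_
    · rintro y ⟨-, hlt⟩
      by_cases hac : ∀ a, PY a = 0 → empType y a = 0
      · have hout := ac_of_klDiv_ne_top (hlt.trans_le le_top).ne
        rw [klDiv_of_ac hout, EReal.coe_lt_coe_iff] at hlt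
        obtain ⟨h0, hm⟩ := admissible_mass hn y (hσ y)
        have hin := (hσ y).2.1
        have := hS (σ y) (mem_feasible h0 hm (hσ y).2.2 (by rwa [hin]) hout) (by linarith)
        rw [hin] at this
        rw [klDiv_of_ac hac]
        exact EReal.coe_le_coe_iff.2 this
      · rw [klDiv_of_not_ac hac]
        exact le_top
    · rw [pow_card_eq_rpow hn, ← Real.rpow_add two_pos]
      refine Real.rpow_le_rpow_of_exponent_le one_le_two ?_
      nlinarith

/-- For every `c` above the exponent, an attacker that reaches `optRegion` whenever possible
achieves a false negative exponent of at most `c`. -/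
lemma eventually_rate_le (hPX : PX ∈ stdSimplex ℝ α) (hPY : ∀ a, 0 ≤ PY a) {S₀ : α → α → ℝ}
    (hS₀ : S₀ ∈ feasible d PX PY L) (h₀ : klSum (outMarginal S₀) PX < l) {c : ℝ}
    (hc : exponent d PX PY L l < c) :
    ∀ᶠ n : ℕ in atTop, ∀ Λ, optRegion n PX l ⊆ Λ → ∀ σ, Reaches n d L (optRegion n PX l) σ →
      rate n (falseNeg PY Λ σ) ≤ c := by
  obtain ⟨S, hS, hSl, hSc⟩ := exists_feasible_lt_lt hPX hS₀ h₀ hc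
  obtain ⟨N, hN, hNf, hNlim⟩ := exists_grid_feasible hS
  have hpe := tendsto_polyExponent (α := α)
  have hout := (((continuous_klSum_out (PX := PX)).tendsto S).comp hNlim).add hpe
  have hin := (((continuous_klSum_in (PY := PY)).tendsto S).comp hNlim).add hpe
  rw [add_zero] at hout hin
  filter_upwards [eventually_gt_atTop 0, hout.eventually (gt_mem_nhds hSl),
    hin.eventually (gt_mem_nhds hSc)] with n hn h1 h2 Λ hΛ σ hσ
  have hn' : (0 : ℝ) < n := by positivity
  set T : α → α → ℝ := fun i j => (N n i j : ℝ) / n with hT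
  change klSum (outMarginal T) PX + _ < _ at h1
  change klSum (inMarginal T) PY + _ < _ at h2
  have hTf : T ∈ feasible d PX PY L := hNf n hn
  obtain ⟨y₀, hy₀⟩ := mem_types_of_count (fun i => ∑ j, N n i j) (hN n)
  have hTin : inMarginal T = empType y₀ := by
    rw [hy₀]
    funext i
    simp only [inMarginal, hT, ← Finset.sum_div]
    push_cast; rfl
  have hTadm : T ∈ admissible n d L (empType y₀) := ⟨⟨N n, fun i j => rfl⟩, hTin, hTf.2.1⟩
  have hTopt : outMarginal T ∈ optRegion n PX l := by
    refine ⟨outMarginal_mem_types hn y₀ hTadm, ?_⟩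
    rw [klDiv_of_ac (feasible.out_ac hTf), EReal.coe_lt_coe_iff]
    change _ < l - polyExponent α n
    linarith
  have hac : ∀ a, PY a = 0 → empType y₀ a = 0 := hTin ▸ feasible.in_ac hTf
  refine rate_le_of_le hn ?_
  have hlow := le_seqProb_empType_eq hn hPY y₀ hac
  have hle : seqProb PY {x : Fin n → α | empType x = empType y₀} ≤ falseNeg PY Λ σ := by
    refine seqProb_mono hPY fun y hy => hΛ (hσ.2 y T ?_ hTopt)
    rwa [show empType y = empType y₀ from hy]
  rw [pow_card_eq_rpow hn, ← hTin] at hlow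
  have h3 := mul_le_mul_of_nonneg_left hlow
    (Real.rpow_pos_of_pos two_pos (-(polyExponent α n * n))).le
  rw [← mul_assoc, ← Real.rpow_add two_pos, ← Real.rpow_add two_pos, neg_add_cancel,
    Real.rpow_zero, one_mul, hTin] at h3
  refine le_trans (Real.rpow_le_rpow_of_exponent_le one_le_two ?_) (h3.trans hle)
  rw [← hTin]
  nlinarith

/-- The exponent governs the game, except possibly if `l` is exactly the least divergence from `PX`
of the second marginal of a feasible map; there `exponent` jumps from `⊤` to a finite value, and the
alternative in the hypothesis excludes this case. -/
lemma isFalseNegExponent_exponent (hPX : PX ∈ stdSimplex ℝ α) (hPY : ∀ a, 0 ≤ PY a)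
    (hd0 : ∀ i, d i i = 0) (hL : 0 ≤ L)
    (h : (∃ S ∈ feasible d PX PY L, klSum (outMarginal S) PX < l) ∨ exponent d PX PY L l = ⊤) :
    IsFalseNegExponent d PX PY L l (exponent d PX PY L l) := by
  have hupper : ∀ b, exponent d PX PY L l < b → ∃ c : ℝ, (c : EReal) < b ∧
      ∀ᶠ n : ℕ in atTop, ∀ Λ, optRegion n PX l ⊆ Λ → ∀ σ, Reaches n d L (optRegion n PX l) σ →
        rate n (falseNeg PY Λ σ) ≤ c := by
    intro b hb
    obtain ⟨c, hc, hcb⟩ := EReal.lt_iff_exists_real_btwn.1 hb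
    rcases h with ⟨S₀, hS₀, h₀⟩ | h
    · exact ⟨c, hcb, eventually_rate_le hPX hPY hS₀ h₀ hc⟩
    · rw [h] at hb
      exact absurd hb not_top_lt
  refine ⟨tendsto_order.2 ⟨fun a ha => ?_, fun b hb => ?_⟩, fun σ hσ =>
    tendsto_order.2 ⟨fun a ha => ?_, fun b hb => ?_⟩⟩
  · obtain ⟨c, hac, hc⟩ := EReal.lt_iff_exists_real_btwn.1 ha
    filter_upwards [eventually_gt_atTop 0, eventually_exists_region hPX.1 hPY hc] with n hn hΛ
    obtain ⟨Λ, hΛ, -, hle⟩ := hΛ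
    refine hac.trans_le (le_trans ?_ (le_iSup₂ (f := fun Λ _ => ⨅ σ ∈ attackerStrategies n d L,
      rate n (falseNeg PY Λ σ)) Λ hΛ))
    exact le_iInf₂ fun σ hσ => le_rate_of_le hn (seqProb_nonneg hPY _) (hle σ hσ)
  · obtain ⟨c, hcb, hc⟩ := hupper b hb
    filter_upwards [eventually_gt_atTop 0, hc] with n hn hle
    refine lt_of_le_of_lt (iSup₂_le fun Λ hΛ => ?_) hcb
    obtain ⟨σ, hσ⟩ := exists_reaches hd0 hL n (optRegion n PX l)
    exact (iInf₂_le σ hσ.1).trans (hle Λ (optRegion_subset hPX.1 hn hΛ) σ hσ)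
  · obtain ⟨c, hac, hc⟩ := EReal.lt_iff_exists_real_btwn.1 ha
    filter_upwards [eventually_gt_atTop 0, eventually_exists_region hPX.1 hPY hc] with n hn hΛ
    obtain ⟨Λ, -, hsub, hle⟩ := hΛ
    exact hac.trans_le (le_rate_of_le hn (seqProb_nonneg hPY _)
      ((falseNeg_mono hPY hsub _).trans (hle _ (hσ n hn).1)))
  · obtain ⟨c, hcb, hc⟩ := hupper b hb
    filter_upwards [eventually_gt_atTop 0, hc] with n hn hle
    exact (hle _ subset_rfl _ (IsOptAttack.reaches hn (hσ n hn))).trans_lt hcb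

/-- If `PY` cannot be moved onto `PX`, the exponent at `0` is positive by Gibbs' inequality, hence
also the exponent at some `l > 0`. -/
lemma reliablyDistinguishable_of_lt_emd (hPX : PX ∈ stdSimplex ℝ α) (hPY : PY ∈ stdSimplex ℝ α)
    (hd0 : ∀ i, d i i = 0) (hL : 0 ≤ L) (h : L < emd d PY PX) :
    ReliablyDistinguishable d PX PY L := by
  have hpos : ((0 : ℝ) : EReal) < exponent d PX PY L 0 := by
    obtain ⟨P₀, hP₀, heq⟩ := exists_mem_emdBall_klDiv_eq (PY := PY) hd0 hL hPX
    rw [← heq]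
    by_cases hac : ∀ a, PY a = 0 → P₀ a = 0
    · rw [klDiv_of_ac hac, EReal.coe_lt_coe_iff]
      by_contra hcon
      rw [eq_of_klSum_nonpos hP₀.1 hPY hac (not_lt.1 hcon)] at hP₀
      exact absurd hP₀.2 (not_le.2 h)
    · rw [klDiv_of_not_ac hac]
      exact EReal.coe_lt_top _
  obtain ⟨e, he, hlt⟩ := EReal.lt_iff_exists_real_btwn.1 hpos
  obtain ⟨l, hl, hl0⟩ :=
    ((tendsto_exponent.eventually (lt_mem_nhds hlt)).and self_mem_nhdsWithin).exists
  refine ⟨l, hl0, e, EReal.coe_lt_coe_iff.1 he, ?_⟩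
  filter_upwards [eventually_exists_region hPX.1 hPY.1 hl] with n hΛ
  obtain ⟨Λ, hΛ, -, hle⟩ := hΛ
  exact ⟨Λ, hΛ, hle⟩

/-- If `PY` can be moved onto `PX`, the exponent vanishes for every `l > 0`, so the value of the
game has no exponential decay. -/
lemma lt_emd_of_reliablyDistinguishable (hPX : PX ∈ stdSimplex ℝ α) (hPY : PY ∈ stdSimplex ℝ α)
    (hd0 : ∀ i, d i i = 0) (hL : 0 ≤ L) (h : ReliablyDistinguishable d PX PY L) :
    L < emd d PY PX := by
  by_contra hcon
  obtain ⟨l, hl, e, he, hev⟩ := h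
  obtain ⟨S, h0, h1, h2, hc⟩ := (emd_le_iff hPY hPX).1 (not_lt.1 hcon)
  have hS : S ∈ feasible d PX PY L := by
    refine mem_feasible h0 ?_ hc (by simp [h1]) (by simp [h2])
    rw [← hPY.2, ← h1]; rfl
  have hout : klSum (outMarginal S) PX = 0 := by rw [h2, klSum_self]
  have hexp : exponent d PX PY L l ≤ ((0 : ℝ) : EReal) := by
    have := exponent_le hS (hout.trans_le hl.le)
    rwa [h1, klSum_self] at this
  have hlim := (isFalseNegExponent_exponent hPX hPY.1 hd0 hL
    (Or.inl ⟨S, hS, hout.trans_lt hl⟩)).1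
  have hge : (e : EReal) ≤ exponent d PX PY L l := by
    refine ge_of_tendsto hlim ?_
    filter_upwards [eventually_gt_atTop 0, hev] with n hn hΛ
    obtain ⟨Λ, hΛ, hle⟩ := hΛ
    refine le_trans ?_ (le_iSup₂ (f := fun Λ _ => ⨅ σ ∈ attackerStrategies n d L,
      rate n (falseNeg PY Λ σ)) Λ hΛ)
    exact le_iInf₂ fun σ hσ => le_rate_of_le hn (seqProb_nonneg hPY.1 _) (hle σ hσ)
  exact absurd (EReal.coe_le_coe_iff.1 (hge.trans hexp)) (not_le.2 he)

end Game

end SourceId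

theorem theorem3 {α : Type*} [Fintype α] [DecidableEq α]
    (PX PY : α → ℝ) (hPX : PX ∈ stdSimplex ℝ α) (hPY : PY ∈ stdSimplex ℝ α)
    (d : α → α → ℝ) (hd : ∀ i j, 0 ≤ d i j) (hd0 : ∀ i, d i i = 0)
    (L : ℝ) (hL : 0 ≤ L) :
    (∃ P₀ ∈ SourceId.emdBall d PX L,
      (∀ P ∈ SourceId.emdBall d PX L, SourceId.klDiv P₀ PY ≤ SourceId.klDiv P PY) ∧
      ∃ ε : ℝ → EReal,
        (∀ᶠ l in 𝓝[>] (0 : ℝ), SourceId.IsFalseNegExponent d PX PY L l (ε l)) ∧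
        ((∀ a, PY a = 0 → PX a = 0) →
          ∀ l > 0, SourceId.IsFalseNegExponent d PX PY L l (ε l)) ∧
        Tendsto ε (𝓝[>] (0 : ℝ)) (𝓝 (SourceId.klDiv P₀ PY))) ∧
    (SourceId.ReliablyDistinguishable d PX PY L ↔ L < SourceId.emd d PY PX) := by
  refine ⟨?_, SourceId.lt_emd_of_reliablyDistinguishable hPX hPY hd0 hL,
    SourceId.reliablyDistinguishable_of_lt_emd hPX hPY hd0 hL⟩
  obtain ⟨P₀, hP₀, heq⟩ := SourceId.exists_mem_emdBall_klDiv_eq (PY := PY) hd0 hL hPX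
  refine ⟨P₀, hP₀, fun P hP => heq.trans_le (SourceId.exponent_zero_le_klDiv hPX hP),
    SourceId.exponent d PX PY L, ?_, fun hac l hl => ?_, heq ▸ SourceId.tendsto_exponent⟩
  · rcases SourceId.exists_or_eventually_exponent_eq_top (d := d) (PX := PX) (PY := PY) (L := L)
      with ⟨S, hS, hS0⟩ | htop
    · filter_upwards [self_mem_nhdsWithin] with l hl
      exact SourceId.isFalseNegExponent_exponent hPX hPY.1 hd0 hL
        (Or.inl ⟨S, hS, lt_of_le_of_lt hS0 hl⟩)
    · filter_upwards [htop] with l hl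
      exact SourceId.isFalseNegExponent_exponent hPX hPY.1 hd0 hL (Or.inr hl)
  · obtain ⟨S, hS, hS0⟩ := SourceId.exists_feasible_of_ac hPX hd0 hL hac
    exact SourceId.isFalseNegExponent_exponent hPX hPY.1 hd0 hL
      (Or.inl ⟨S, hS, hS0.trans_lt hl⟩)
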